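/- All graphs are finite and simple. For a graph $G$, a strong clique of $G$ is a set of edges of $G$ every two of which are incident (share an endpoint) or connected by an edge of $G$ (some edge of $G$ joins an endpoint of one to an endpoint of the other). The strong clique number $\omega_2'(G)$ is the size of a largest strong clique of $G$. For $\ell\ge 3$, $G$ is called $C_\ell$-free if it contains no cycle of length $\ell$ as a (not necessarily induced) subgraph, and triangle-free if it is $C_3$-free. Theorem. Let $G$ be a graph with maximum degree $\Delta$. (i) If $G$ is triangle-free, then $\omega_2'(G)\le \tfrac54\Delta^2$. (ii) If $G$ is $C_5$-free, then $\omega_2'(G)\le\Delta^2$. (iii) For every integer $k\ge 3$, if $G$ is $C_{2k+1}$-free and $\Delta\ge 3k^2+10k$, then $\omega_2'(G)\le\Delta^2$. -/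

import Mathlib

namespace SimpleGraph

/-- A strong clique of `G`: a set of edges of `G`, every two of which are incident
or connected by an edge of `G`. -/
def IsStrongClique {V : Type*} (G : SimpleGraph V) (S : Set (Sym2 V)) : Prop :=
  S ⊆ G.edgeSet ∧
    ∀ e ∈ S, ∀ f ∈ S, e ≠ f →
      (∃ v, v ∈ e ∧ v ∈ f) ∨ (∃ u ∈ e, ∃ v ∈ f, G.Adj u v)

/-- The strong clique number `ω₂'(G)`: the largest size of a strong clique of `G`.
For a finite graph the set below is nonempty and bounded, so its supremum is a maximum. -/
noncomputable def strongCliqueNum {V : Type*} (G : SimpleGraph V) : ℕ :=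
  sSup {n : ℕ | ∃ S : Finset (Sym2 V), G.IsStrongClique (S : Set (Sym2 V)) ∧ S.card = n}

end SimpleGraph

/-!
Let `S` be a strong clique, and let `d` be the maximum `S`-degree, attained at `u`. Everything rests
on one observation: an edge of `S` that misses `N(u)` is joined to each edge `uv` of `S` through
`v`, so each `S`-neighbour `v` of `u` is adjacent to one of its ends
(`IsStrongClique.adj_or_adj`).

Suppose every edge `xy` of `S` missing `N(u)` has an end, say `x`, complete to the set `B` of
`S`-neighbours of `u`. Such an `x` emits at most `d = |B|` edges of `S`, no more than the number of
edges of `G` it sends to `B`. Hence `S` is no larger than the number of pairs of a vertex in `N(u)`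
and a neighbour of it, which is at most `Δ ^ 2` (`card_le_sum_add_sum`,
`IsStrongClique.card_le_maxDegree_sq`). In a `C₅`-free graph the supposition always holds, because
otherwise two members of `B` together with `u`, `x`, `y` span a `C₅`.

In a triangle-free graph, at most `Δ d` edges of `S` meet `N(u)`. On each of the others, `B` is the
disjoint union of the neighbourhoods in `B` of the two ends, so outside `N(u)` the degrees of the
ends sum to at most `2Δ - d`, and the edges behave as in a bipartite graph. Counting them around a
vertex `a` of maximum degree `e` gives at most `e (2Δ - d - e) ≤ (Δ - d / 2) ^ 2`, for a total of
`Δ ^ 2 + d ^ 2 / 4`. The exceptional case where `a` is complete to `B` has smaller degrees and is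
bounded directly, as is the case `2d ≤ Δ`.

In a `C_{2k+1}`-free graph with `k ≥ 3`, suppose `S` has more than `Δ ^ 2` edges. Some `N(w)` then
contains a core: a set `D` of more than `2k` vertices of large `S`-degree, any two of which have
many common neighbours (`IsStrongClique.exists_isCore`). Thus any two vertices of `D` are joined by
paths of every short even length, and a short path of odd length between them would give a cycle of
length `2k + 1`. Every edge of `S` is attached to each vertex of `D`, and by parity
the attachments orient it consistently (`IsCore.isOriented_or`), so that two oriented edges are
always joined from the tail of one to the head of the other, as in a bipartite graph
(`IsCore.adj_or_adj_of_isOriented`). The supposition of the second paragraph follows.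
-/

namespace SimpleGraph

/-! ### Counting the edges of a strong clique -/

lemma IsStrongClique.adj {V : Type*} {G : SimpleGraph V} {S : Finset (Sym2 V)}
    (hS : G.IsStrongClique (S : Set (Sym2 V))) {x y : V} (h : s(x, y) ∈ S) :
    G.Adj x y :=
  hS.1 (Finset.mem_coe.2 h)

/-- An edge of a strong clique that misses the neighbourhood of `u` is joined to any other edge
`uv` of the clique through `v`. -/
lemma IsStrongClique.adj_or_adj {V : Type*} {G : SimpleGraph V} {S : Finset (Sym2 V)}
    (hS : G.IsStrongClique (S : Set (Sym2 V))) {u v x y : V}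
    (huv : s(u, v) ∈ S) (hxy : s(x, y) ∈ S) (hx : ¬ G.Adj u x) (hy : ¬ G.Adj u y) :
    G.Adj v x ∨ G.Adj v y := by
  have h1 := hS.adj huv
  have h2 := hS.adj hxy
  by_cases hne : s(u, v) = s(x, y)
  · rcases Sym2.eq_iff.1 hne with ⟨rfl, rfl⟩ | ⟨rfl, rfl⟩
    · exact absurd h1 hy
    · exact absurd h1 hx
  · rcases hS.2 _ huv _ hxy hne with ⟨w, hw1, hw2⟩ | ⟨a, ha, b, hb, hab⟩
    · rcases Sym2.mem_iff.1 hw1 with rfl | rfl <;> rcases Sym2.mem_iff.1 hw2 with rfl | rfl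
      · exact absurd h2 hy
      · exact absurd h2.symm hx
      · exact absurd h1 hx
      · exact absurd h1 hy
    · rcases Sym2.mem_iff.1 ha with rfl | rfl <;> rcases Sym2.mem_iff.1 hb with rfl | rfl
      · exact absurd hab hx
      · exact absurd hab hy
      · exact Or.inl hab
      · exact Or.inr hab

lemma strongCliqueNum_le {V : Type*} {G : SimpleGraph V} {n : ℕ}
    (h : ∀ S : Finset (Sym2 V), G.IsStrongClique (S : Set (Sym2 V)) → S.card ≤ n) :
    G.strongCliqueNum ≤ n := by
  refine csSup_le ⟨0, ∅, ⟨by simp, by simp⟩, rfl⟩ ?_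
  rintro _ ⟨S, hS, rfl⟩
  exact h S hS

section Counting

variable {V : Type*} [Fintype V] [DecidableEq V] {G : SimpleGraph V} [DecidableRel G.Adj]
  {S : Finset (Sym2 V)}

/-- The neighbours of `x` along the edges of `S`. Its cardinality is the degree of `x` in the
subgraph with edge set `S`. -/
def edgeNbrs (S : Finset (Sym2 V)) (x : V) : Finset V :=
  Finset.univ.filter fun y => s(x, y) ∈ S

@[simp]
lemma mem_edgeNbrs {x y : V} : y ∈ edgeNbrs S x ↔ s(x, y) ∈ S := by
  simp [edgeNbrs]

lemma edgeNbrs_mono {T : Finset (Sym2 V)} (h : T ⊆ S) (x : V) : edgeNbrs T x ⊆ edgeNbrs S x := by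
  intro y hy
  simp only [mem_edgeNbrs] at hy ⊢
  exact h hy

lemma IsStrongClique.edgeNbrs_subset (hS : G.IsStrongClique (S : Set (Sym2 V))) (x : V) :
    edgeNbrs S x ⊆ G.neighborFinset x := by
  intro y hy
  simpa using hS.adj (mem_edgeNbrs.1 hy)

lemma card_le_sum_card_edgeNbrs {N : Finset V} (h : ∀ x y, s(x, y) ∈ S → x ∈ N ∨ y ∈ N) :
    S.card ≤ ∑ w ∈ N, (edgeNbrs S w).card := by
  have hsub : S ⊆ N.biUnion fun w => (edgeNbrs S w).image fun y => s(w, y) := by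
    intro e he
    induction e with
    | _ x y =>
      simp only [Finset.mem_biUnion, Finset.mem_image, mem_edgeNbrs]
      rcases h x y he with hx | hy
      · exact ⟨x, hx, y, he, rfl⟩
      · exact ⟨y, hy, x, by rwa [Sym2.eq_swap], Sym2.eq_swap⟩
  calc S.card ≤ _ := Finset.card_le_card hsub
    _ ≤ ∑ w ∈ N, ((edgeNbrs S w).image fun y => s(w, y)).card := Finset.card_biUnion_le
    _ ≤ _ := Finset.sum_le_sum fun w _ => Finset.card_image_le

/-- The counting lemma behind all three bounds. Orient each edge `xy` of `S` so that `y ∈ N` or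
`x` is complete to `B`. A vertex `x` complete to `B` emits at most `|B|` edges, no more than the
number of edges of `G` joining `x` to `B`; any other `x` emits only edges into `N`. So the edges
emitted by `x` are at most the `G`-edges from `x` to `B` plus the `S`-edges from `x` to `N \ B`.
The set `O` contains all vertices incident with `S`. -/
lemma card_le_sum_add_sum {N B O : Finset V} (hSG : ∀ x y, s(x, y) ∈ S → G.Adj x y)
    (hB : ∀ x, (edgeNbrs S x).card ≤ B.card) (hO : ∀ x y, s(x, y) ∈ S → x ∈ O)
    (hcover : ∀ x y, s(x, y) ∈ S →
      x ∈ N ∨ y ∈ N ∨ (∀ b ∈ B, G.Adj b x) ∨ (∀ b ∈ B, G.Adj b y)) :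
    S.card ≤ ∑ b ∈ B, (O.filter fun x => G.Adj b x).card +
      ∑ y ∈ N \ B, (edgeNbrs S y).card := by
  set T : V → Finset V := fun x =>
    (edgeNbrs S x).filter fun y => y ∈ N ∨ ∀ b ∈ B, G.Adj b x with hT
  have hsub : S ⊆ O.biUnion fun x => (T x).image fun y => s(x, y) := by
    intro e he
    induction e with
    | _ x y =>
      have he' : s(y, x) ∈ S := by rwa [Sym2.eq_swap]
      have hx := hO x y he
      have hy := hO y x he'
      simp only [hT, Finset.mem_biUnion, Finset.mem_image, Finset.mem_filter, mem_edgeNbrs]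
      rcases hcover x y he with h | h | h | h
      · exact ⟨y, hy, x, ⟨he', Or.inl h⟩, Sym2.eq_swap⟩
      · exact ⟨x, hx, y, ⟨he, Or.inl h⟩, rfl⟩
      · exact ⟨x, hx, y, ⟨he, Or.inr h⟩, rfl⟩
      · exact ⟨y, hy, x, ⟨he', Or.inr h⟩, Sym2.eq_swap⟩
  have hTle : ∀ x, (T x).card ≤ (B.filter fun b => G.Adj b x).card +
      ((N \ B).filter fun y => s(x, y) ∈ S).card := by
    intro x
    by_cases hx : ∀ b ∈ B, G.Adj b x
    · rw [Finset.filter_true_of_mem hx]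
      exact ((Finset.card_le_card (Finset.filter_subset _ _)).trans (hB x)).trans
        (Nat.le_add_right _ _)
    · refine (Finset.card_le_card ?_).trans (Finset.card_union_le _ _)
      intro y hy
      simp only [hT, Finset.mem_filter, mem_edgeNbrs, hx, or_false] at hy
      simp only [Finset.mem_union, Finset.mem_filter, Finset.mem_sdiff]
      by_cases hyB : y ∈ B
      · exact Or.inl ⟨hyB, (hSG x y hy.1).symm⟩
      · exact Or.inr ⟨⟨hy.2, hyB⟩, hy.1⟩
  calc S.card ≤ _ := Finset.card_le_card hsub
    _ ≤ ∑ x ∈ O, ((T x).image fun y => s(x, y)).card := Finset.card_biUnion_le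
    _ ≤ ∑ x ∈ O, (T x).card := Finset.sum_le_sum fun w _ => Finset.card_image_le
    _ ≤ ∑ x ∈ O, ((B.filter fun b => G.Adj b x).card +
          ((N \ B).filter fun y => s(x, y) ∈ S).card) := Finset.sum_le_sum fun x _ => hTle x
    _ = ∑ x ∈ O, (B.filter fun b => G.Adj b x).card +
          ∑ x ∈ O, ((N \ B).filter fun y => s(x, y) ∈ S).card := Finset.sum_add_distrib
    _ = ∑ b ∈ B, (O.filter fun x => G.Adj b x).card +
          ∑ y ∈ N \ B, (O.filter fun x => s(x, y) ∈ S).card := by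
        congr 1
        · exact (Finset.sum_card_bipartiteAbove_eq_sum_card_bipartiteBelow
            (s := B) (t := O) (fun b x => G.Adj b x)).symm
        · exact Finset.sum_card_bipartiteAbove_eq_sum_card_bipartiteBelow
            (s := O) (t := N \ B) (fun x y => s(x, y) ∈ S)
    _ ≤ _ := by
        gcongr with y
        intro x hx
        rw [Finset.mem_filter] at hx
        rw [mem_edgeNbrs, Sym2.eq_swap]
        exact hx.2

lemma exists_card_edgeNbrs_max [Nonempty V] (S : Finset (Sym2 V)) :
    ∃ u, ∀ x, (edgeNbrs S x).card ≤ (edgeNbrs S u).card := by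
  obtain ⟨u, -, hu⟩ := Finset.exists_max_image Finset.univ (fun x => (edgeNbrs S x).card)
    Finset.univ_nonempty
  exact ⟨u, fun x => hu x (Finset.mem_univ x)⟩

lemma sum_card_edgeNbrs_le_mul {N : Finset V} {d : ℕ} (hd : ∀ x, (edgeNbrs S x).card ≤ d) :
    ∑ w ∈ N, (edgeNbrs S w).card ≤ N.card * d := by
  simpa using Finset.sum_le_card_nsmul N _ d fun x _ => hd x

lemma IsStrongClique.card_edgeNbrs_le (hS : G.IsStrongClique (S : Set (Sym2 V))) (x : V) :
    (edgeNbrs S x).card ≤ G.maxDegree :=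
  (Finset.card_le_card (hS.edgeNbrs_subset x)).trans (G.degree_le_maxDegree x)

/-- Every edge of a strong clique meets the neighbourhood of any fixed edge of it. -/
lemma IsStrongClique.card_le_sum_add_sum_neighborFinset
    (hS : G.IsStrongClique (S : Set (Sym2 V))) {u v : V} (huv : s(u, v) ∈ S) :
    S.card ≤ ∑ w ∈ G.neighborFinset u, (edgeNbrs S w).card +
      ∑ w ∈ G.neighborFinset v, (edgeNbrs S w).card := by
  refine (card_le_sum_card_edgeNbrs (N := G.neighborFinset u ∪ G.neighborFinset v) ?_).trans ?_
  · intro x y hxy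
    simp only [Finset.mem_union, mem_neighborFinset]
    by_contra! h
    rcases hS.adj_or_adj huv hxy h.1.1 h.2.1 with h' | h'
    · exact h.1.2 h'
    · exact h.2.2 h'
  · rw [← Finset.sum_union_inter]
    exact Nat.le_add_right _ _

/-- If `u` has maximum degree in the strong clique `S`, and every edge of `S` meets `N(u)` or has
an end complete to the `S`-neighbours of `u`, then `S` has at most `Δ ^ 2` edges. -/
lemma IsStrongClique.card_le_maxDegree_sq (hS : G.IsStrongClique (S : Set (Sym2 V))) {u : V}
    (hu : ∀ x, (edgeNbrs S x).card ≤ (edgeNbrs S u).card)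
    (hcover : ∀ x y, s(x, y) ∈ S → ¬ G.Adj u x → ¬ G.Adj u y →
      (∀ b, s(u, b) ∈ S → G.Adj b x) ∨ (∀ b, s(u, b) ∈ S → G.Adj b y)) :
    S.card ≤ G.maxDegree ^ 2 := by
  have h := card_le_sum_add_sum (G := G) (S := S) (N := G.neighborFinset u) (B := edgeNbrs S u)
    (O := Finset.univ) (fun x y h => hS.adj h) hu (fun x _ _ => Finset.mem_univ x) (by
      intro x y hxy
      simp only [mem_neighborFinset, mem_edgeNbrs]
      have := hcover x y hxy
      tauto)
  have h1 : ∀ b ∈ edgeNbrs S u, (Finset.univ.filter fun x => G.Adj b x).card ≤ G.maxDegree := by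
    intro b _
    rw [← neighborFinset_eq_filter]
    exact G.degree_le_maxDegree b
  calc S.card ≤ _ := h
    _ ≤ (edgeNbrs S u).card * G.maxDegree +
        (G.neighborFinset u \ edgeNbrs S u).card * G.maxDegree := by
      gcongr
      · simpa using Finset.sum_le_card_nsmul _ _ _ h1
      · exact sum_card_edgeNbrs_le_mul hS.card_edgeNbrs_le
    _ = (G.neighborFinset u).card * G.maxDegree := by
      rw [← add_mul, add_comm, Finset.card_sdiff_add_card_eq_card (hS.edgeNbrs_subset u)]
    _ ≤ G.maxDegree * G.maxDegree := by
      gcongr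
      exact G.degree_le_maxDegree u
    _ = _ := (sq _).symm

end Counting

/-! ### Paths avoiding a set, and closing them to cycles -/

section Paths

variable {V : Type*} {G : SimpleGraph V}

/-- There is a path with `n` edges from `a` to `b` none of whose vertices, ends included, lies
in `X`. -/
def HasPathAvoiding (G : SimpleGraph V) (n : ℕ) (X : Finset V) (a b : V) : Prop :=
  ∃ p : G.Walk a b, p.IsPath ∧ p.length = n ∧ ∀ v ∈ p.support, v ∉ X

namespace HasPathAvoiding

variable {n : ℕ} {X Y : Finset V} {a b c : V}

lemma refl (h : a ∉ X) : G.HasPathAvoiding 0 X a a :=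
  ⟨Walk.nil, by simp, by simp, by simpa using h⟩

lemma mono (h : G.HasPathAvoiding n X a b) (hY : Y ⊆ X) : G.HasPathAvoiding n Y a b := by
  obtain ⟨p, hp, hl, hX⟩ := h
  exact ⟨p, hp, hl, fun v hv hvY => hX v hv (hY hvY)⟩

lemma symm (h : G.HasPathAvoiding n X a b) : G.HasPathAvoiding n X b a := by
  obtain ⟨p, hp, hl, hX⟩ := h
  exact ⟨p.reverse, hp.reverse, by simpa using hl, by simpa using hX⟩

variable [DecidableEq V]

lemma cons (h : G.HasPathAvoiding n (insert c X) a b) (hca : G.Adj c a) (hc : c ∉ X) :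
    G.HasPathAvoiding (n + 1) X c b := by
  obtain ⟨p, hp, hl, hX⟩ := h
  refine ⟨p.cons hca, ?_, by simpa using hl, ?_⟩
  · rw [Walk.cons_isPath_iff]
    exact ⟨hp, fun hcp => hX c hcp (Finset.mem_insert_self _ _)⟩
  · intro v hv
    rw [Walk.support_cons, List.mem_cons] at hv
    rcases hv with rfl | hv
    · exact hc
    · exact fun hvX => hX v hv (Finset.mem_insert_of_mem hvX)

/-- A path extends at its first vertex through some member of a large set of neighbours. -/
lemma exists_cons (h : G.HasPathAvoiding n X a b) {M : Finset V} (hM : ∀ v ∈ M, G.Adj v a)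
    (hcard : n + X.card < M.card) : ∃ c ∈ M, G.HasPathAvoiding (n + 1) X c b := by
  obtain ⟨p, hp, hl, hX⟩ := h
  have hlt : (p.support.tail.toFinset ∪ X).card < M.card := by
    refine lt_of_le_of_lt ((Finset.card_union_le _ _).trans ?_) hcard
    gcongr
    exact (List.toFinset_card_le _).trans (by simp [hl])
  obtain ⟨c, hcM, hc⟩ := Finset.exists_mem_notMem_of_card_lt_card hlt
  simp only [Finset.mem_union, List.mem_toFinset, not_or] at hc
  refine ⟨c, hcM, cons ⟨p, hp, hl, ?_⟩ (hM c hcM) hc.2⟩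
  intro v hv hvX
  rcases Finset.mem_insert.1 hvX with rfl | hvX
  · rw [← p.cons_tail_support, List.mem_cons] at hv
    exact hv.elim (hM v hcM).ne hc.1
  · exact hX v hv hvX

end HasPathAvoiding

/-- A path on `n` vertices whose ends are adjacent gives a copy of the cycle of length `n`. -/
lemma HasPathAvoiding.not_free {n : ℕ} {X : Finset V} {a b : V}
    (h : G.HasPathAvoiding n X a b) (hab : G.Adj a b) : ¬ (cycleGraph (n + 1)).Free G := by
  obtain ⟨p, hp, hl, -⟩ := h
  rw [SimpleGraph.not_free]
  refine ⟨⟨⟨fun i => p.getVert i, ?_⟩, ?_⟩⟩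
  · have key : ∀ i j : Fin (n + 1), (i - j).val = 1 → G.Adj (p.getVert i) (p.getVert j) := by
      intro i j hij
      rcases le_or_gt j i with hle | hlt
      · rw [Fin.sub_val_of_le hle] at hij
        have h1 : (i : ℕ) = j + 1 := by have := Fin.le_def.1 hle; omega
        rw [h1]
        exact (p.adj_getVert_succ (by have := i.2; omega)).symm
      · have h2 : (i - j).val = n + 1 - j + i := by
          rw [Fin.coe_sub_iff_lt.2 hlt]
          have := j.2
          omega
        have h3 : (i : ℕ) = 0 := by have := j.2; omega
        have h4 : (j : ℕ) = p.length := by have := j.2; omega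
        rw [h3, h4, p.getVert_zero, p.getVert_length]
        exact hab
    intro i j hij
    rcases cycleGraph_adj'.1 hij with h1 | h1
    · exact key i j h1
    · exact (key j i h1).symm
  · intro i j hij
    refine Fin.ext (hp.getVert_injOn ?_ ?_ hij)
    · exact (Nat.le_of_lt_succ i.2).trans_eq hl.symm
    · exact (Nat.le_of_lt_succ j.2).trans_eq hl.symm

lemma HasPathAvoiding.not_free_of_eq {n k : ℕ} {X : Finset V} {x y : V}
    (h : G.HasPathAvoiding n X x y) (hn : n = 2 * k) (hxy : G.Adj x y) :
    ¬ (cycleGraph (2 * k + 1)).Free G := by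
  subst hn
  exact h.not_free hxy

variable [DecidableEq V]

/-- Paths of odd length between the sides of a large complete bipartite subgraph. -/
lemma hasPathAvoiding_of_complete {A B : Finset V} (hAB : ∀ a ∈ A, ∀ b ∈ B, G.Adj a b) :
    ∀ (m : ℕ) {X : Finset V} {a b : V}, X.card + 2 * m < A.card → X.card + 2 * m < B.card →
      a ∈ A → b ∈ B → a ∉ X → b ∉ X → G.HasPathAvoiding (2 * m + 1) X a b := by
  intro m
  induction m with
  | zero =>
    intro X a b _ _ ha hb haX hbX
    have hab := hAB a ha b hb
    refine HasPathAvoiding.cons (HasPathAvoiding.refl ?_) hab haX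
    simp [hab.ne', hbX]
  | succ m ih =>
    intro X a b hA hB ha hb haX hbX
    have hB' : (insert b X).card < B.card := (Finset.card_insert_le _ _).trans_lt (by omega)
    have hA' : (insert a X).card < A.card := (Finset.card_insert_le _ _).trans_lt (by omega)
    obtain ⟨b', hb'B, hb'⟩ := Finset.exists_mem_notMem_of_card_lt_card hB'
    obtain ⟨a', ha'A, ha'⟩ := Finset.exists_mem_notMem_of_card_lt_card hA'
    simp only [Finset.mem_insert, not_or] at ha' hb'
    have hcard : (insert b' (insert a X)).card ≤ X.card + 2 :=
      (Finset.card_insert_le _ _).trans (Nat.succ_le_succ (Finset.card_insert_le _ _))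
    have hab := hAB a ha b hb
    have hab' := hAB a ha b' hb'B
    have ha'b' := hAB a' ha'A b' hb'B
    have hp : G.HasPathAvoiding (2 * m + 1) (insert b' (insert a X)) a' b :=
      ih (by omega) (by omega) ha'A hb (by simp [ha'.1, ha'.2, ha'b'.ne])
        (by simp [hab.ne', hbX, Ne.symm hb'.1])
    exact (hp.cons ha'b'.symm (by simp [hab'.ne', hb'.2])).cons hab' haX

/-- If any two vertices of a large set `D` have many common neighbours, then any two of them are
joined by paths of every short even length. -/
lemma hasPathAvoiding_even [Fintype V] [DecidableRel G.Adj] {D : Finset V} {c : ℕ}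
    (hc : c < D.card)
    (hD : ∀ z ∈ D, ∀ z' ∈ D, z ≠ z' → c < (G.neighborFinset z ∩ G.neighborFinset z').card) :
    ∀ (m : ℕ) {X : Finset V} {z z' : V}, X.card + 2 * m ≤ c → z ∈ D → z' ∈ D → z ∉ X → z' ∉ X →
      (m = 0 ↔ z = z') → G.HasPathAvoiding (2 * m) X z z' := by
  intro m
  induction m with
  | zero =>
    intro X z z' _ _ _ hz _ h
    obtain rfl := h.1 rfl
    exact HasPathAvoiding.refl hz
  | succ m ih =>
    intro X z z' hX hz hz' hzX hz'X h
    have hne : z ≠ z' := fun e => by simpa using h.2 e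
    obtain ⟨y, hyD, hyz, hyX, hy⟩ :
        ∃ y ∈ D, y ≠ z ∧ y ∉ X ∧ (m = 0 ↔ y = z') := by
      rcases Nat.eq_zero_or_pos m with rfl | hm
      · exact ⟨z', hz', hne.symm, hz'X, by simp⟩
      · have : (insert z (insert z' X)).card < D.card :=
          ((Finset.card_insert_le _ _).trans
            (Nat.succ_le_succ (Finset.card_insert_le _ _))).trans_lt (by omega)
        obtain ⟨y, hyD, hy⟩ := Finset.exists_mem_notMem_of_card_lt_card this
        simp only [Finset.mem_insert, not_or] at hy
        exact ⟨y, hyD, hy.1, hy.2.2, by simp [hy.2.1, hm.ne']⟩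
    have hlt : (insert z' X).card < (G.neighborFinset z ∩ G.neighborFinset y).card :=
      (Finset.card_insert_le _ _).trans_lt
        (lt_of_le_of_lt (by omega) (hD z hz y hyD hyz.symm))
    obtain ⟨a, ha, haX⟩ := Finset.exists_mem_notMem_of_card_lt_card hlt
    simp only [Finset.mem_inter, mem_neighborFinset] at ha
    simp only [Finset.mem_insert, not_or] at haX
    have hcard : (insert a (insert z X)).card ≤ X.card + 2 :=
      (Finset.card_insert_le _ _).trans (Nat.succ_le_succ (Finset.card_insert_le _ _))
    have hp : G.HasPathAvoiding (2 * m) (insert a (insert z X)) y z' :=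
      ih (by omega) hyD hz' (by simp [ha.2.ne, hyz, hyX])
        (by simp [Ne.symm haX.1, hne.symm, hz'X]) hy
    exact (hp.cons ha.2.symm (by simp [ha.1.ne', haX.2])).cons ha.1 hzX

end Paths

/-! ### Cores and the odd cycles they create -/

section Core

variable {V : Type*} [Fintype V] [DecidableEq V] {G : SimpleGraph V} [DecidableRel G.Adj]
  {S : Finset (Sym2 V)} {k : ℕ} {D : Finset V} {x y x' y' z z' : V}

/-- A core of the strong clique `S`: a set `D` of more than `2k` vertices, any two of which have
more than `2k` common neighbours, and each of which has more than `4k` neighbours along `S`. -/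
structure IsCore (G : SimpleGraph V) [DecidableRel G.Adj] (S : Finset (Sym2 V)) (k : ℕ)
    (D : Finset V) : Prop where
  lt_card : 2 * k < D.card
  lt_card_inter : ∀ z ∈ D, ∀ z' ∈ D, z ≠ z' →
    2 * k < (G.neighborFinset z ∩ G.neighborFinset z').card
  lt_card_edgeNbrs : ∀ z ∈ D, 4 * k < (edgeNbrs S z).card

/-- The vertex `x` has more than `2k` neighbours among the `S`-neighbours of `z`, hence is joined
to `z` by many paths of length two. -/
def IsFarAttached (G : SimpleGraph V) [DecidableRel G.Adj] (S : Finset (Sym2 V)) (k : ℕ)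
    (x z : V) : Prop :=
  2 * k < (edgeNbrs S z ∩ G.neighborFinset x).card

/-- The oriented edge `(x, y)` is attached to `z` if `y` is adjacent to `z` or `x` is far attached
to `z`. Either way `x` behaves like a vertex on the side of `z` in a bipartite graph, and `y` like
a vertex on the opposite side. -/
def IsAttached (G : SimpleGraph V) [DecidableRel G.Adj] (S : Finset (Sym2 V)) (k : ℕ)
    (x y z : V) : Prop :=
  G.Adj y z ∨ G.IsFarAttached S k x z

lemma IsStrongClique.isAttached_or (hS : G.IsStrongClique (S : Set (Sym2 V)))
    (hz : 4 * k < (edgeNbrs S z).card) (hxy : s(x, y) ∈ S) :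
    G.IsAttached S k x y z ∨ G.IsAttached S k y x z := by
  by_cases hx : G.Adj z x
  · exact Or.inr (Or.inl hx.symm)
  by_cases hy : G.Adj z y
  · exact Or.inl (Or.inl hy.symm)
  have hsub : edgeNbrs S z ⊆
      (edgeNbrs S z ∩ G.neighborFinset x) ∪ (edgeNbrs S z ∩ G.neighborFinset y) := by
    intro v hv
    have := hS.adj_or_adj (mem_edgeNbrs.1 hv) hxy hx hy
    simp only [Finset.mem_union, Finset.mem_inter, hv, mem_neighborFinset, true_and]
    exact this.imp (fun h => h.symm) fun h => h.symm
  have hcard := (Finset.card_le_card hsub).trans (Finset.card_union_le _ _)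
  by_contra! h
  have h1 : ¬ 2 * k < (edgeNbrs S z ∩ G.neighborFinset x).card := fun h' => h.1 (Or.inr h')
  have h2 : ¬ 2 * k < (edgeNbrs S z ∩ G.neighborFinset y).card := fun h' => h.2 (Or.inr h')
  omega

lemma IsFarAttached.hasPathAvoiding (h : G.IsFarAttached S k x z)
    (hS : G.IsStrongClique (S : Set (Sym2 V))) {n : ℕ} {X : Finset V}
    (hp : G.HasPathAvoiding n (insert x X) z z') (hx : x ∉ X) (hcard : n + X.card + 2 ≤ 2 * k) :
    G.HasPathAvoiding (n + 2) X x z' := by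
  have hX : (insert x X).card = X.card + 1 := Finset.card_insert_of_notMem hx
  obtain ⟨c, hc, hcp⟩ := hp.exists_cons (M := edgeNbrs S z ∩ G.neighborFinset x)
    (fun v hv => (hS.adj (mem_edgeNbrs.1 (Finset.mem_inter.1 hv).1)).symm)
    (lt_of_le_of_lt (by omega) h)
  have hxc : G.Adj x c := by simpa using (Finset.mem_inter.1 hc).2
  exact hcp.cons hxc hx

namespace IsCore

/-- A core contains a vertex outside any set of at most five vertices, provided `k ≥ 3`. -/
lemma exists_notMem (hD : G.IsCore S k D) (hk : 3 ≤ k) {X : Finset V} (hX : X.card ≤ 5) :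
    ∃ z ∈ D, z ∉ X := by
  have := hD.lt_card
  exact Finset.exists_mem_notMem_of_card_lt_card (by omega)

lemma hasPathAvoiding (hD : G.IsCore S k D) {m : ℕ} {X : Finset V} (hX : X.card + 2 * m ≤ 2 * k)
    (hz : z ∈ D) (hz' : z' ∈ D) (hzX : z ∉ X) (hzX' : z' ∉ X) (h : m = 0 ↔ z = z') :
    G.HasPathAvoiding (2 * m) X z z' :=
  hasPathAvoiding_even hD.lt_card hD.lt_card_inter m hX hz hz' hzX hzX' h

variable (hD : G.IsCore S k D) (hS : G.IsStrongClique (S : Set (Sym2 V))) (hk : 3 ≤ k)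
  (hz : z ∈ D) (hz' : z' ∈ D)
include hD hk hz hz'

/-- The ends of an edge cannot both be adjacent to the core: the edge would close an even path in
the core to an odd cycle. The following lemmas exclude, in the same way, each further pair of
attachments of the wrong parity. -/
lemma not_free_of_near_near (hne : z ≠ z') (hxy : G.Adj x y)
    (hzX : z ∉ ({x, y} : Finset V)) (hzX' : z' ∉ ({x, y} : Finset V))
    (h : G.Adj y z) (h' : G.Adj x z') : ¬ (cycleGraph (2 * k + 1)).Free G := by
  have p0 : G.HasPathAvoiding (2 * (k - 1)) {x, y} z z' :=
    hD.hasPathAvoiding (by have := Finset.card_le_two (a := x) (b := y); omega) hz hz' hzX hzX'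
      (by simp only [hne, iff_false]; omega)
  have p1 : G.HasPathAvoiding _ {x} y z' := (p0.mono (by grind)).cons h (by simp [hxy.ne'])
  have p2 : G.HasPathAvoiding _ ∅ x y := (p1.symm.mono (by simp)).cons h' (by simp)
  exact p2.not_free_of_eq (by omega) hxy

/-- A path `y x x' y'` whose ends are adjacent to the core. -/
lemma not_free_of_near_near_of_path (hne : z ≠ z') (hyx : G.Adj y x) (hxx' : G.Adj x x')
    (hx'y' : G.Adj x' y') (hyx' : y ≠ x') (hxy' : x ≠ y') (hyy' : y ≠ y')
    (hzX : z ∉ ({x, y, x', y'} : Finset V)) (hzX' : z' ∉ ({x, y, x', y'} : Finset V))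
    (h : G.Adj y z) (h' : G.Adj y' z') : ¬ (cycleGraph (2 * k + 1)).Free G := by
  have p0 : G.HasPathAvoiding (2 * (k - 2)) {x, y, x', y'} z z' :=
    hD.hasPathAvoiding (by
      have := Finset.card_le_four (a := x) (b := y) (c := x') (d := y'); omega) hz hz' hzX hzX'
      (by simp only [hne, iff_false]; omega)
  have p1 : G.HasPathAvoiding _ {x, x', y'} y z' :=
    (p0.mono (by grind)).cons h (by grind [hyx.ne])
  have p2 : G.HasPathAvoiding _ {x', y'} x z' :=
    (p1.mono (by grind)).cons hyx.symm (by grind [hxx'.ne])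
  have p3 : G.HasPathAvoiding _ {x'} y' x :=
    (p2.symm.mono (by grind)).cons h' (by grind [hx'y'.ne])
  have p4 : G.HasPathAvoiding _ ∅ x' x := (p3.mono (by simp)).cons hx'y' (by simp)
  exact p4.not_free_of_eq (by omega) hxx'.symm

include hS

lemma not_free_of_near_far (hne : z ≠ z') (hyz : y ≠ z) (hyz' : y ≠ z')
    (h : G.Adj y z) (h' : G.IsFarAttached S k y z') : ¬ (cycleGraph (2 * k + 1)).Free G := by
  have p0 : G.HasPathAvoiding (2 * (k - 1)) {y} z' z :=
    hD.hasPathAvoiding (by rw [Finset.card_singleton]; omega) hz' hz (by simpa using hyz'.symm)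
      (by simpa using hyz.symm) (by simp only [hne.symm, iff_false]; omega)
  have p1 : G.HasPathAvoiding _ ∅ y z :=
    h'.hasPathAvoiding hS (p0.mono (by simp)) (by simp) (by rw [Finset.card_empty]; omega)
  exact p1.not_free_of_eq (by omega) h

lemma not_free_of_far_far (hne : z ≠ z') (hxy : G.Adj x y)
    (hzX : z ∉ ({x, y} : Finset V)) (hzX' : z' ∉ ({x, y} : Finset V))
    (h : G.IsFarAttached S k x z) (h' : G.IsFarAttached S k y z') :
    ¬ (cycleGraph (2 * k + 1)).Free G := by
  have p0 : G.HasPathAvoiding (2 * (k - 2)) {x, y} z z' :=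
    hD.hasPathAvoiding (by have := Finset.card_le_two (a := x) (b := y); omega) hz hz' hzX hzX'
      (by simp only [hne, iff_false]; omega)
  have p1 : G.HasPathAvoiding _ {y} x z' :=
    h.hasPathAvoiding hS p0 (by simp [hxy.ne]) (by rw [Finset.card_singleton]; omega)
  have p2 : G.HasPathAvoiding _ ∅ y x :=
    h'.hasPathAvoiding hS (p1.symm.mono (by simp)) (by simp) (by rw [Finset.card_empty]; omega)
  exact p2.not_free_of_eq (by omega) hxy.symm

/-- A path `y x x'` with `y` adjacent and `x'` far attached to the core. -/
lemma not_free_of_near_far_of_path (hne : z ≠ z') (hyx : G.Adj y x) (hxx' : G.Adj x x')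
    (hyx' : y ≠ x') (hzX : z ∉ ({x, y, x'} : Finset V)) (hzX' : z' ∉ ({x, y, x'} : Finset V))
    (h : G.Adj y z) (h' : G.IsFarAttached S k x' z') : ¬ (cycleGraph (2 * k + 1)).Free G := by
  have p0 : G.HasPathAvoiding (2 * (k - 2)) {x, y, x'} z z' :=
    hD.hasPathAvoiding (by
      have := Finset.card_le_three (a := x) (b := y) (c := x'); omega) hz hz' hzX hzX'
      (by simp only [hne, iff_false]; omega)
  have p1 : G.HasPathAvoiding _ {x, x'} y z' :=
    (p0.mono (by grind)).cons h (by grind [hyx.ne])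
  have p2 : G.HasPathAvoiding _ {x'} x z' :=
    (p1.mono (by grind)).cons hyx.symm (by grind [hxx'.ne])
  have p3 : G.HasPathAvoiding _ ∅ x' x :=
    h'.hasPathAvoiding hS (p2.symm.mono (by simp)) (by simp) (by rw [Finset.card_empty]; omega)
  exact p3.not_free_of_eq (by omega) hxx'.symm

/-- A path `x y y' x'` whose ends are far attached to the core. For `k = 3` the two far
attachments must be at the same vertex: the resulting cycle of length seven has room for a single
vertex of the core. -/
lemma not_free_of_far_far_of_path (hzz' : k = 3 ↔ z = z') (hxy : G.Adj x y) (hyy' : G.Adj y y')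
    (hy'x' : G.Adj y' x') (hxx' : x ≠ x') (hxy' : x ≠ y') (hyx' : y ≠ x')
    (hzX : z ∉ ({x, y, x', y'} : Finset V)) (hzX' : z' ∉ ({x, y, x', y'} : Finset V))
    (h : G.IsFarAttached S k x z) (h' : G.IsFarAttached S k x' z') :
    ¬ (cycleGraph (2 * k + 1)).Free G := by
  have p0 : G.HasPathAvoiding (2 * (k - 3)) {x, y, x', y'} z z' :=
    hD.hasPathAvoiding (by
      have := Finset.card_le_four (a := x) (b := y) (c := x') (d := y'); omega) hz hz' hzX hzX'
      (by rw [← hzz']; omega)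
  have p1 : G.HasPathAvoiding _ {y, x', y'} x z' :=
    h.hasPathAvoiding hS p0 (by grind [hxy.ne]) (by
      have := Finset.card_le_three (a := y) (b := x') (c := y'); omega)
  have p2 : G.HasPathAvoiding _ {y, y'} x' x :=
    h'.hasPathAvoiding hS (p1.symm.mono (by grind)) (by grind [hy'x'.ne]) (by
      have := Finset.card_le_two (a := y) (b := y'); omega)
  have p3 : G.HasPathAvoiding _ {y} y' x := (p2.mono (by grind)).cons hy'x' (by grind [hyy'.ne])
  have p4 : G.HasPathAvoiding _ ∅ y x := (p3.mono (by simp)).cons hyy' (by simp)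
  exact p4.not_free_of_eq (by omega) hxy.symm

end IsCore

end Core

/-! ### Orienting a strong clique along a core -/

section Orientation

variable {V : Type*} [Fintype V] [DecidableEq V] {G : SimpleGraph V} [DecidableRel G.Adj]
  {S : Finset (Sym2 V)} {k : ℕ} {D : Finset V} {x y x' y' : V}

/-- The ordered pair `(x, y)` is attached to every vertex of `D` other than `x` and `y`. -/
def IsOriented (G : SimpleGraph V) [DecidableRel G.Adj] (S : Finset (Sym2 V)) (k : ℕ)
    (D : Finset V) (x y : V) : Prop :=
  ∀ z ∈ D, z ≠ x → z ≠ y → G.IsAttached S k x y z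

namespace IsCore

variable (hD : G.IsCore S k D) (hS : G.IsStrongClique (S : Set (Sym2 V))) (hk : 3 ≤ k)
  (hfree : (cycleGraph (2 * k + 1)).Free G)
include hD hS hk hfree

/-- Attached edges cannot be consecutive. The case `x' = y` says that an edge is not attached in
both directions. -/
lemma not_isAttached_of_isAttached {z z' : V} (hz : z ∈ D) (hz' : z' ∈ D) (hne : z ≠ z')
    (hxy : G.Adj x y) (hx'x : G.Adj x' x) (hzX : z ∉ ({x, y, x'} : Finset V))
    (hzX' : z' ∉ ({x, y, x'} : Finset V)) (h : G.IsAttached S k x y z) :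
    ¬ G.IsAttached S k x' x z' := by
  intro h'
  revert hfree
  rcases h with h | h <;> rcases h' with h' | h'
  · exact hD.not_free_of_near_near hk hz hz' hne hxy (by grind) (by grind) h h'
  · by_cases hx'y : x' = y
    · subst hx'y
      exact hD.not_free_of_near_far hS hk hz hz' hne (by grind) (by grind) h h'
    · exact hD.not_free_of_near_far_of_path hS hk hz hz' hne hxy.symm hx'x.symm (Ne.symm hx'y)
        hzX hzX' h h'
  · exact hD.not_free_of_near_far hS hk hz' hz hne.symm (by grind) (by grind) h' h
  · exact hD.not_free_of_far_far hS hk hz hz' hne hx'x.symm (by grind) (by grind) h h'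

lemma isOriented_or (hxy : s(x, y) ∈ S) :
    G.IsOriented S k D x y ∨ G.IsOriented S k D y x := by
  by_contra! h
  simp only [IsOriented, not_forall, exists_prop] at h
  obtain ⟨⟨z, hz, hzx, hzy, hzA⟩, z', hz', hz'y, hz'x, hz'A⟩ := h
  have h1 := (hS.isAttached_or (hD.lt_card_edgeNbrs z hz) hxy).resolve_left hzA
  have h2 := (hS.isAttached_or (hD.lt_card_edgeNbrs z' hz') hxy).resolve_right hz'A
  have hne : z ≠ z' := fun e => hzA (e ▸ h2)
  exact hD.not_isAttached_of_isAttached hS hk hfree hz' hz hne.symm (hS.adj hxy)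
    (hS.adj hxy).symm (by grind) (by grind) h2 h1

lemma not_isOriented_of_isOriented (hxy : s(x, y) ∈ S) (hx'x : s(x', x) ∈ S)
    (h : G.IsOriented S k D x y) : ¬ G.IsOriented S k D x' x := by
  intro h'
  obtain ⟨z, hz, hzX⟩ := hD.exists_notMem hk (X := {x, y, x'})
    (Finset.card_le_three.trans (by norm_num))
  obtain ⟨z', hz', hzX'⟩ := hD.exists_notMem hk (X := {z, x, y, x'})
    (Finset.card_le_four.trans (by norm_num))
  exact hD.not_isAttached_of_isAttached hS hk hfree hz hz' (by grind) (hS.adj hxy) (hS.adj hx'x)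
    hzX (by grind) (h z hz (by grind) (by grind)) (h' z' hz' (by grind) (by grind))

/-- Two oriented edges of a strong clique are joined across, as in a bipartite graph. -/
lemma adj_or_adj_of_isOriented (hxy : s(x, y) ∈ S) (hx'y' : s(x', y') ∈ S)
    (h : G.IsOriented S k D x y) (h' : G.IsOriented S k D x' y') :
    G.Adj x y' ∨ G.Adj x' y := by
  by_contra! hcross
  have axy := hS.adj hxy
  have axy' := hS.adj hx'y'
  have hxx' : x ≠ x' := by rintro rfl; exact hcross.1 axy'
  have hyy' : y ≠ y' := by rintro rfl; exact hcross.1 axy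
  have hxy' : x ≠ y' := by
    rintro rfl; exact hD.not_isOriented_of_isOriented hS hk hfree hxy hx'y' h h'
  have hyx' : y ≠ x' := by
    rintro rfl; exact hD.not_isOriented_of_isOriented hS hk hfree hx'y' hxy h' h
  obtain ⟨z, hz, hzX⟩ := hD.exists_notMem hk (X := {x, y, x', y'})
    (Finset.card_le_four.trans (by norm_num))
  obtain ⟨z', hz', hzX'⟩ := hD.exists_notMem hk (X := {z, x, y, x', y'}) Finset.card_le_five
  have hne : z ≠ z' := by grind
  have hzX'' : z' ∉ ({x, y, x', y'} : Finset V) := by grind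
  have att : ∀ v ∈ D, v ∉ ({x, y, x', y'} : Finset V) →
      G.IsAttached S k x y v ∧ G.IsAttached S k x' y' v := fun v hv hvX =>
    ⟨h v hv (by grind) (by grind), h' v hv (by grind) (by grind)⟩
  have a1 := (att z hz hzX).1
  have a2 := (att z' hz' hzX'').2
  have hj : G.Adj x x' ∨ G.Adj y y' := by
    by_cases hx : G.Adj x x'
    · exact Or.inl hx
    · exact Or.inr ((hS.adj_or_adj hxy hx'y' hx hcross.1).resolve_left fun e => hcross.2 e.symm)
  rcases hj with hj | hj
  · revert hfree
    rcases a1 with a1 | a1 <;> rcases a2 with a2 | a2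
    · exact hD.not_free_of_near_near_of_path hk hz hz' hne axy.symm hj axy' hyx' hxy' hyy'
        hzX hzX'' a1 a2
    · exact hD.not_free_of_near_far_of_path hS hk hz hz' hne axy.symm hj hyx' (by grind)
        (by grind) a1 a2
    · exact hD.not_free_of_near_far_of_path hS hk hz' hz hne.symm axy'.symm hj.symm hxy'.symm
        (by grind) (by grind) a2 a1
    · exact hD.not_free_of_far_far hS hk hz hz' hne hj (by grind) (by grind) a1 a2
  · rcases a1 with a1 | a1
    · revert hfree
      rcases a2 with a2 | a2
      · exact hD.not_free_of_near_near hk hz hz' hne hj.symm (by grind) (by grind) a1 a2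
      · exact hD.not_free_of_near_far_of_path hS hk hz hz' hne hj axy'.symm hyx' (by grind)
          (by grind) a1 a2
    · -- Two far attachments close up at a single core vertex when `k = 3`, at two otherwise.
      obtain ⟨v, hv, hvX, hkv⟩ :
          ∃ v ∈ D, v ∉ ({x, y, x', y'} : Finset V) ∧ (k = 3 ↔ z = v) := by
        by_cases h3 : k = 3
        · exact ⟨z, hz, hzX, by simp [h3]⟩
        · exact ⟨z', hz', hzX'', by simp [h3, hne]⟩
      rcases (att v hv hvX).2 with a3 | a3
      · by_cases hzv : z = v
        · subst hzv
          -- This cycle needs two distinct core vertices: `(x, y)` is attached at `z'` instead.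
          rcases (att z' hz' hzX'').1 with a4 | a4
          · exact hD.not_free_of_near_near hk hz' hz hne.symm hj.symm (by grind) (by grind)
              a4 a3 hfree
          · exact hD.not_free_of_near_far_of_path hS hk hz hz' hne hj.symm axy.symm hxy'.symm
              (by grind) (by grind) a3 a4 hfree
        · exact hD.not_free_of_near_far_of_path hS hk hv hz (Ne.symm hzv) hj.symm axy.symm
            hxy'.symm (by grind) (by grind) a3 a1 hfree
      · exact hD.not_free_of_far_far_of_path hS hk hz hv hkv axy hj axy'.symm hxx' hxy' hyx'
          hzX hvX a1 a3 hfree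

/-- A strong clique with a core is bounded as in the bipartite case. -/
lemma card_le_maxDegree_sq : S.card ≤ G.maxDegree ^ 2 := by
  obtain ⟨z, -, -⟩ := hD.exists_notMem hk (X := ∅) (by simp)
  have : Nonempty V := ⟨z⟩
  obtain ⟨u, hu⟩ := exists_card_edgeNbrs_max S
  have cross := fun {a b c d : V} => hD.adj_or_adj_of_isOriented hS hk hfree
    (x := a) (y := b) (x' := c) (y' := d)
  -- The edges at `u` are all directed away from `u` or all directed towards `u`.
  have hdir : (∀ b, s(u, b) ∈ S → G.IsOriented S k D u b) ∨
      ∀ b, s(u, b) ∈ S → G.IsOriented S k D b u := by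
    by_contra! h
    obtain ⟨⟨b, hb, hb'⟩, c, hc, hc'⟩ := h
    exact hD.not_isOriented_of_isOriented hS hk hfree hc (by rwa [Sym2.eq_swap])
      ((hD.isOriented_or hS hk hfree hc).resolve_right hc')
      ((hD.isOriented_or hS hk hfree hb).resolve_left hb')
  refine hS.card_le_maxDegree_sq hu fun x y hxy hx hy => ?_
  have hyx : s(y, x) ∈ S := by rwa [Sym2.eq_swap]
  rcases hdir with hdir | hdir <;> rcases hD.isOriented_or hS hk hfree hxy with ho | ho
  · exact Or.inl fun b hb => ((cross hb hxy (hdir b hb) ho).resolve_left hy).symm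
  · exact Or.inr fun b hb => ((cross hb hyx (hdir b hb) ho).resolve_left hx).symm
  · exact Or.inr fun b hb => (cross (by rwa [Sym2.eq_swap]) hxy (hdir b hb) ho).resolve_right
      fun e => hx e.symm
  · exact Or.inl fun b hb => (cross (by rwa [Sym2.eq_swap]) hyx (hdir b hb) ho).resolve_right
      fun e => hy e.symm

end IsCore

end Orientation

/-! ### Finding a core in a large strong clique -/

section FindCore

variable {V : Type*} [Fintype V] [DecidableEq V] {G : SimpleGraph V} [DecidableRel G.Adj]
  {S : Finset (Sym2 V)} {k : ℕ} {D : Finset V} {w : V}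

/-- Two nonadjacent neighbours `z, z'` of `w` with large `S`-degree have many common neighbours.
Otherwise the `S`-neighbours of `z` outside `N(z')` and those of `z'` outside `N(z)` form a large
complete bipartite graph, which together with `z`, `w`, `z'` contains all odd cycles of length
between five and `2k + 1`. -/
lemma IsStrongClique.lt_card_inter_of_free (hS : G.IsStrongClique (S : Set (Sym2 V)))
    (hk : 2 ≤ k) (hfree : (cycleGraph (2 * k + 1)).Free G) {z z' : V} (hwz : G.Adj w z)
    (hwz' : G.Adj w z') (hne : z ≠ z') (hzz' : ¬ G.Adj z z') (hz : 4 * k < (edgeNbrs S z).card)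
    (hz' : 4 * k < (edgeNbrs S z').card) :
    2 * k < (G.neighborFinset z ∩ G.neighborFinset z').card := by
  by_contra! hle
  set A := edgeNbrs S z \ G.neighborFinset z' with hA
  set B := edgeNbrs S z' \ G.neighborFinset z with hB
  have hAcard : 2 * k < A.card := by
    have h1 := Finset.card_inter_add_card_sdiff (edgeNbrs S z) (G.neighborFinset z')
    rw [← hA] at h1
    have h2 : (edgeNbrs S z ∩ G.neighborFinset z').card ≤
        (G.neighborFinset z ∩ G.neighborFinset z').card :=
      Finset.card_le_card (Finset.inter_subset_inter_right (hS.edgeNbrs_subset z))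
    omega
  have hBcard : 2 * k < B.card := by
    have h1 := Finset.card_inter_add_card_sdiff (edgeNbrs S z') (G.neighborFinset z)
    rw [← hB] at h1
    have h2 : (edgeNbrs S z' ∩ G.neighborFinset z).card ≤
        (G.neighborFinset z ∩ G.neighborFinset z').card := by
      rw [Finset.inter_comm]
      exact Finset.card_le_card (Finset.inter_subset_inter_left (hS.edgeNbrs_subset z'))
    omega
  have hAB : ∀ a ∈ A, ∀ b ∈ B, G.Adj a b := by
    intro a ha b hb
    simp only [hA, hB, Finset.mem_sdiff, mem_edgeNbrs, mem_neighborFinset] at ha hb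
    exact (hS.adj_or_adj ha.1 hb.1 hzz' hb.2).resolve_left fun e => ha.2 e.symm
  have hX : ({z, z', w} : Finset V).card ≤ 3 := Finset.card_le_three
  obtain ⟨a, haA⟩ : A.Nonempty := Finset.card_pos.1 (by omega)
  obtain ⟨b, hbB⟩ : B.Nonempty := Finset.card_pos.1 (by omega)
  have ha := haA
  have hb := hbB
  simp only [hA, hB, Finset.mem_sdiff, mem_edgeNbrs, mem_neighborFinset] at ha hb
  have hza := hS.adj ha.1
  have hz'b := hS.adj hb.1
  have haw : a ≠ w := by rintro rfl; exact ha.2 hwz'.symm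
  have hbw : b ≠ w := by rintro rfl; exact hb.2 hwz.symm
  have haz' : a ≠ z' := by rintro rfl; exact hzz' hza
  have hbz : b ≠ z := by rintro rfl; exact hzz' hz'b.symm
  have p0 : G.HasPathAvoiding (2 * (k - 2) + 1) {z, z', w} a b :=
    hasPathAvoiding_of_complete hAB (k - 2) (by omega) (by omega) haA hbB
      (by simp [hza.ne', haz', haw]) (by simp [hz'b.ne', hbz, hbw])
  have p1 : G.HasPathAvoiding _ {z', w} z b := p0.cons hza (by simp [hne, hwz.ne'])
  have p2 : G.HasPathAvoiding _ {w} z' z := p1.symm.cons hz'b (by simp [hwz'.ne'])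
  have p3 : G.HasPathAvoiding _ ∅ w z := (p2.mono (by simp)).cons hwz' (by simp)
  exact p3.not_free_of_eq (by omega) hwz hfree

/-- If any two vertices of a large set `D ⊆ N(w)` are adjacent or have many common neighbours,
then an edge inside `D` yields a cycle of length `2k + 1`. Starting from an edge `z₀z₁` in `D`, a
path through `D` grows by steps of length one or two. If it skips the required length `2k - 1`,
dropping `z₀` repairs this. The cycle is closed through `w`. -/
lemma not_free_of_adj_mem (hk : 1 ≤ k) (hcard : 2 * k < D.card) (hw : ∀ z ∈ D, G.Adj w z)
    (hcommon : ∀ z ∈ D, ∀ z' ∈ D, z ≠ z' → ¬ G.Adj z z' →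
      2 * k < (G.neighborFinset z ∩ G.neighborFinset z').card)
    {z₀ z₁ : V} (hz₀ : z₀ ∈ D) (hz₁ : z₁ ∈ D) (hadj : G.Adj z₀ z₁) :
    ¬ (cycleGraph (2 * k + 1)).Free G := by
  have hwD : w ∉ D := fun h => G.irrefl (hw w h)
  have grow : ∀ n, n ≤ 2 * k - 2 → ∃ z ∈ D, G.HasPathAvoiding n {z₀, w} z z₁ ∨
      G.HasPathAvoiding (n + 1) {z₀, w} z z₁ := by
    intro n
    induction n with
    | zero =>
      intro _
      exact ⟨z₁, hz₁, Or.inl (HasPathAvoiding.refl (by simp [hadj.ne', (hw z₁ hz₁).ne']))⟩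
    | succ n ih =>
      intro hn
      obtain ⟨z, hz, hp | hp⟩ := ih (by omega)
      · obtain ⟨p, hpath, hl, hX⟩ := id hp
        have hsupp : p.support.toFinset.card ≤ n + 1 :=
          (List.toFinset_card_le _).trans (by simp [hl])
        have h1 : (insert z₀ p.support.toFinset).card < D.card :=
          (Finset.card_insert_le _ _).trans_lt (by omega)
        obtain ⟨y, hyD, hy⟩ := Finset.exists_mem_notMem_of_card_lt_card h1
        simp only [Finset.mem_insert, List.mem_toFinset, not_or] at hy
        have hyw : y ≠ w := fun e => hwD (e ▸ hyD)
        have hyz : z ≠ y := by rintro rfl; exact hy.2 p.start_mem_support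
        have hpy : G.HasPathAvoiding n (insert y {z₀, w}) z z₁ :=
          ⟨p, hpath, hl, fun v hv hvX => by
            rcases Finset.mem_insert.1 hvX with rfl | hvX
            · exact hy.2 hv
            · exact hX v hv hvX⟩
        have hyX : y ∉ ({z₀, w} : Finset V) := by simp [hy.1, hyw]
        by_cases hzy : G.Adj z y
        · exact ⟨y, hyD, Or.inl (hpy.cons hzy.symm hyX)⟩
        · have h3 : (insert y {z₀, w} : Finset V).card ≤ 3 := Finset.card_le_three
          obtain ⟨c, hc, hcp⟩ := hpy.exists_cons
            (M := G.neighborFinset z ∩ G.neighborFinset y)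
            (fun v hv => ((mem_neighborFinset _ _ _).1 (Finset.mem_inter.1 hv).1).symm)
            (lt_of_le_of_lt (by omega) (hcommon z hz y hyD hyz hzy))
          have hyc : G.Adj y c := (mem_neighborFinset _ _ _).1 (Finset.mem_inter.1 hc).2
          exact ⟨y, hyD, Or.inr (hcp.cons hyc hyX)⟩
      · exact ⟨z, hz, Or.inl hp⟩
  obtain ⟨z, hz, hp | hp⟩ := grow (2 * k - 2) le_rfl
  · have p1 : G.HasPathAvoiding _ {w} z₀ z := hp.symm.cons hadj (by simp [(hw z₀ hz₀).ne'])
    have p2 : G.HasPathAvoiding _ ∅ w z := (p1.mono (by simp)).cons (hw z₀ hz₀) (by simp)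
    exact p2.not_free_of_eq (by omega) (hw z hz)
  · have p1 : G.HasPathAvoiding _ ∅ w z₁ := (hp.mono (by simp)).cons (hw z hz) (by simp)
    exact p1.not_free_of_eq (by omega) (hw z₁ hz₁)

/-- A strong clique with more than `Δ ^ 2` edges in a `C_{2k+1}`-free graph has a core: the
vertices of large `S`-degree in a suitable neighbourhood. -/
lemma IsStrongClique.exists_isCore (hS : G.IsStrongClique (S : Set (Sym2 V))) (hk : 2 ≤ k)
    (hfree : (cycleGraph (2 * k + 1)).Free G) (hΔ : 12 * k ≤ G.maxDegree)
    (hcard : G.maxDegree ^ 2 < S.card) : ∃ D, G.IsCore S k D := by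
  obtain ⟨e, he⟩ : S.Nonempty := Finset.card_pos.1 (by omega)
  obtain ⟨w, hw⟩ : ∃ w, S.card ≤ 2 * ∑ z ∈ G.neighborFinset w, (edgeNbrs S z).card := by
    induction e with
    | _ u v =>
      have h := hS.card_le_sum_add_sum_neighborFinset he
      by_contra! hlt
      have h1 := hlt u
      have h2 := hlt v
      omega
  set D := (G.neighborFinset w).filter fun z => 4 * k < (edgeNbrs S z).card with hDdef
  have hmem : ∀ z, z ∈ D ↔ G.Adj w z ∧ 4 * k < (edgeNbrs S z).card := by
    intro z
    simp [hDdef]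
  have hsum : ∑ z ∈ G.neighborFinset w, (edgeNbrs S z).card ≤
      D.card * G.maxDegree + G.maxDegree * (4 * k) := by
    rw [← Finset.sum_filter_add_sum_filter_not _ (fun z => 4 * k < (edgeNbrs S z).card)]
    gcongr
    · exact sum_card_edgeNbrs_le_mul hS.card_edgeNbrs_le
    · refine (Finset.sum_le_card_nsmul _ _ (4 * k) fun z hz => ?_).trans ?_
      · exact not_lt.1 (Finset.mem_filter.1 hz).2
      · rw [smul_eq_mul]
        gcongr
        exact (Finset.card_filter_le _ _).trans (G.degree_le_maxDegree w)
  have hDcard : 2 * k < D.card := by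
    by_contra! hle
    have h1 : D.card * G.maxDegree ≤ 2 * k * G.maxDegree := Nat.mul_le_mul_right _ hle
    have h2 : 12 * k * G.maxDegree ≤ G.maxDegree * G.maxDegree := Nat.mul_le_mul_right _ hΔ
    nlinarith
  have hcommon : ∀ z ∈ D, ∀ z' ∈ D, z ≠ z' → ¬ G.Adj z z' →
      2 * k < (G.neighborFinset z ∩ G.neighborFinset z').card := by
    intro z hz z' hz' hne hzz'
    rw [hmem] at hz hz'
    exact hS.lt_card_inter_of_free hk hfree hz.1 hz'.1 hne hzz' hz.2 hz'.2
  refine ⟨D, hDcard, fun z hz z' hz' hne => hcommon z hz z' hz' hne fun hadj => ?_,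
    fun z hz => ((hmem z).1 hz).2⟩
  exact not_free_of_adj_mem (by omega) hDcard (fun z hz => ((hmem z).1 hz).1) hcommon hz hz'
    hadj hfree

end FindCore

/-! ### The three bounds -/

lemma CliqueFree.not_adj {V : Type*} {G : SimpleGraph V} (hG : G.CliqueFree 3) {a b c : V}
    (hab : G.Adj a b) (hbc : G.Adj b c) : ¬ G.Adj a c := by
  classical
  exact fun hac => hG {a, b, c} (is3Clique_triple_iff.2 ⟨hab, hac, hbc⟩)

section Bounds

variable {V : Type*} [Fintype V] [DecidableEq V] {G : SimpleGraph V} [DecidableRel G.Adj]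
  {S : Finset (Sym2 V)}

/-- The case of `C_{2k+1}`-free graphs needs only a linear lower bound on the maximum degree. -/
lemma IsStrongClique.card_le_of_cycleGraph_free (hS : G.IsStrongClique (S : Set (Sym2 V)))
    {k : ℕ} (hk : 3 ≤ k) (hfree : (cycleGraph (2 * k + 1)).Free G)
    (hΔ : 12 * k ≤ G.maxDegree) : S.card ≤ G.maxDegree ^ 2 := by
  by_contra! hlt
  obtain ⟨D, hD⟩ := hS.exists_isCore (by omega) hfree hΔ hlt
  exact hlt.not_ge (hD.card_le_maxDegree_sq hS hk hfree)

/-- In a `C₅`-free graph an edge `xy` missing `N(u)` has an end complete to the `S`-neighbours of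
`u`: otherwise two of these are joined to different ends, and with `u`, `x`, `y` they form a
`C₅`. -/
lemma IsStrongClique.card_le_of_cycleGraph_five_free (hS : G.IsStrongClique (S : Set (Sym2 V)))
    (hfree : (cycleGraph 5).Free G) : S.card ≤ G.maxDegree ^ 2 := by
  cases isEmpty_or_nonempty V
  · simp [Finset.eq_empty_of_isEmpty S]
  obtain ⟨u, hu⟩ := exists_card_edgeNbrs_max S
  refine hS.card_le_maxDegree_sq hu fun x y hxy hx hy => ?_
  by_contra! h
  obtain ⟨⟨v, hv, hvx⟩, v', hv', hvy'⟩ := h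
  have hvy := (hS.adj_or_adj hv hxy hx hy).resolve_left hvx
  have hvx' := (hS.adj_or_adj hv' hxy hx hy).resolve_right hvy'
  have huv := hS.adj hv
  have huv' := hS.adj hv'
  have hadj := hS.adj hxy
  have hux : u ≠ x := by rintro rfl; exact hy hadj
  have huy : u ≠ y := by rintro rfl; exact hx hadj.symm
  have hne : v ≠ v' := by rintro rfl; exact hvx hvx'
  have hne₁ : v ≠ x := by rintro rfl; exact hx huv
  have hne₂ : v' ≠ y := by rintro rfl; exact hy huv'
  have p0 : G.HasPathAvoiding 0 {x, y, v, u} v' v' :=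
    HasPathAvoiding.refl (by simp [hvx'.ne, hne₂, hne.symm, huv'.ne'])
  have p1 := p0.cons hvx'.symm (by simp [hadj.ne, hne₁.symm, hux.symm])
  have p2 := p1.cons hadj.symm (by simp [hvy.ne', huy.symm])
  have p3 := p2.cons hvy (by simp [huv.ne'])
  have p4 : G.HasPathAvoiding 4 ∅ u v' := (p3.mono (by simp)).cons huv (by simp)
  exact p4.not_free huv' hfree

/-- The edges of `S` with no end in `N(u)`. -/
def edgesMissing (G : SimpleGraph V) [DecidableRel G.Adj] (S : Finset (Sym2 V)) (u : V) :
    Finset (Sym2 V) :=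
  S.filter fun e => ∀ x ∈ e, ¬ G.Adj u x

lemma mem_edgesMissing {u x y : V} :
    s(x, y) ∈ G.edgesMissing S u ↔ s(x, y) ∈ S ∧ ¬ G.Adj u x ∧ ¬ G.Adj u y := by
  simp [edgesMissing]

lemma card_le_mul_add_card_edgesMissing {u : V} {d : ℕ} (hd : ∀ x, (edgeNbrs S x).card ≤ d) :
    S.card ≤ G.maxDegree * d + (G.edgesMissing S u).card := by
  have h : (S \ G.edgesMissing S u).card ≤ G.maxDegree * d := by
    refine (card_le_sum_card_edgeNbrs (N := G.neighborFinset u) ?_).trans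
      ((sum_card_edgeNbrs_le_mul fun x => ?_).trans
        (Nat.mul_le_mul_right _ (G.degree_le_maxDegree u)))
    · intro x y hxy
      rw [Finset.mem_sdiff, mem_edgesMissing] at hxy
      simp only [mem_neighborFinset]
      tauto
    · exact (Finset.card_le_card (edgeNbrs_mono Finset.sdiff_subset x)).trans (hd x)
  have := Finset.card_sdiff_add_card_eq_card
    (show G.edgesMissing S u ⊆ S from Finset.filter_subset _ _)
  omega

/-- Here `S` is a strong clique in a triangle-free graph, `u` has `S`-degree `d`, and `a` has
maximum degree along the edges of `S` missing `N(u)`. If some `S`-neighbour `v` of `u` is not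
adjacent to `a`, then for each missing edge exactly one end is adjacent to `v`, which makes the
missing edges behave as in a bipartite graph whose edges have degree sum at most `2Δ - d`. -/
lemma IsStrongClique.card_edgesMissing_le_of_not_adj (hS : G.IsStrongClique (S : Set (Sym2 V)))
    (hG : G.CliqueFree 3) {u v a : V} (huv : s(u, v) ∈ S) (hva : ¬ G.Adj v a)
    (ha : ∀ x, (edgeNbrs (G.edgesMissing S u) x).card ≤ (edgeNbrs (G.edgesMissing S u) a).card) :
    4 * ((G.edgesMissing S u).card : ℤ) ≤ (2 * G.maxDegree - (edgeNbrs S u).card) ^ 2 := by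
  set M := G.edgesMissing S u with hM
  set B := edgeNbrs M a with hB
  set N := G.neighborFinset a \ G.neighborFinset u with hN
  have hMS : ∀ {x y}, s(x, y) ∈ M → s(x, y) ∈ S := fun h => (mem_edgesMissing.1 h).1
  have hBN : B ⊆ N := by
    intro b hb
    rw [hB, mem_edgeNbrs, hM, mem_edgesMissing] at hb
    simpa [hN] using ⟨hS.adj hb.1, hb.2.2⟩
  -- The `S`-neighbours of `u` are split between the neighbours of `a` and those of `b`.
  have hBv : ∀ b ∈ B, ∀ c, s(u, c) ∈ S → ¬ G.Adj c a → G.Adj c b := by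
    intro b hb c hc hca
    rw [hB, mem_edgeNbrs, hM, mem_edgesMissing] at hb
    exact (hS.adj_or_adj hc hb.1 hb.2.1 hb.2.2).resolve_left hca
  have hcount := card_le_sum_add_sum (G := G) (S := M) (N := N) (B := B)
    (O := Finset.univ.filter fun x => ¬ G.Adj u x) (fun x y h => hS.adj (hMS h)) ha
    (fun x y h => by simpa using (mem_edgesMissing.1 h).2.1) (by
      intro x y hxy
      obtain ⟨hxyS, hx, hy⟩ := mem_edgesMissing.1 hxy
      simp only [hN, Finset.mem_sdiff, mem_neighborFinset, hx, hy, not_false_eq_true, and_true]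
      by_cases hax : G.Adj a x
      · exact Or.inl hax
      by_cases hay : G.Adj a y
      · exact Or.inr (Or.inl hay)
      have hab : ∀ b ∈ B, G.Adj b x ∨ G.Adj b y := fun b hb =>
        hS.adj_or_adj (hMS (mem_edgeNbrs.1 hb)) hxyS hax hay
      rcases hS.adj_or_adj huv hxyS hx hy with hvx | hvy
      · exact Or.inr (Or.inr (Or.inr fun b hb =>
          (hab b hb).resolve_left (hG.not_adj (hBv b hb v huv hva).symm hvx)))
      · exact Or.inr (Or.inr (Or.inl fun b hb =>
          (hab b hb).resolve_right (hG.not_adj (hBv b hb v huv hva).symm hvy))))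
  -- `p` and `q` count the `S`-neighbours of `u` that are, respectively are not, adjacent to `a`.
  set p := (edgeNbrs S u ∩ G.neighborFinset a).card with hp
  set q := (edgeNbrs S u \ G.neighborFinset a).card with hq
  have hpq : p + q = (edgeNbrs S u).card := Finset.card_inter_add_card_sdiff _ _
  have hNcard : N.card + p ≤ G.maxDegree := by
    have h1 := Finset.card_sdiff_add_card_inter (G.neighborFinset a) (G.neighborFinset u)
    have h2 : p ≤ (G.neighborFinset a ∩ G.neighborFinset u).card := by
      rw [hp, Finset.inter_comm]
      exact Finset.card_le_card (Finset.inter_subset_inter_left (hS.edgeNbrs_subset u))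
    have h3 : (G.neighborFinset a).card ≤ G.maxDegree := G.degree_le_maxDegree a
    rw [← hN] at h1
    omega
  have hBdeg : ∀ b ∈ B,
      ((Finset.univ.filter fun x => ¬ G.Adj u x).filter fun x => G.Adj b x).card ≤
        G.maxDegree - q := by
    intro b hb
    have h1 : (G.neighborFinset b).card ≤ G.maxDegree := G.degree_le_maxDegree b
    have h2 : edgeNbrs S u \ G.neighborFinset a ⊆ G.neighborFinset b := by
      intro c hc
      simp only [Finset.mem_sdiff, mem_edgeNbrs, mem_neighborFinset] at hc ⊢
      exact (hBv b hb c hc.1 fun h => hc.2 h.symm).symm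
    have h3 := Finset.card_sdiff_add_card_eq_card h2
    have h4 : ((Finset.univ.filter fun x => ¬ G.Adj u x).filter fun x => G.Adj b x) ⊆
        G.neighborFinset b \ (edgeNbrs S u \ G.neighborFinset a) := by
      intro c hc
      simp only [Finset.mem_filter, Finset.mem_univ, true_and] at hc
      simp only [Finset.mem_sdiff, mem_neighborFinset, mem_edgeNbrs, hc.2, true_and]
      exact fun h => hc.1 (hS.adj h.1)
    have h5 := Finset.card_le_card h4
    omega
  have hq' : q ≤ G.maxDegree := by
    have := hS.card_edgeNbrs_le u
    omega
  have h1 := Finset.sum_le_card_nsmul B _ _ hBdeg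
  have h2 : ∑ y ∈ N \ B, (edgeNbrs M y).card ≤ (N \ B).card * B.card :=
    sum_card_edgeNbrs_le_mul ha
  have h3 := Finset.card_sdiff_add_card_eq_card hBN
  have h4 : M.card ≤ B.card * (G.maxDegree - q) + (N \ B).card * B.card := by
    rw [smul_eq_mul] at h1
    omega
  zify [hq'] at h4 h3 hNcard hpq
  have h5 : ((N \ B).card : ℤ) ≤ G.maxDegree - p - B.card := by linarith
  have h6 := mul_le_mul_of_nonneg_right h5 (Int.natCast_nonneg B.card)
  rw [← hpq]
  nlinarith [sq_nonneg (2 * (G.maxDegree : ℤ) - (p + q) - 2 * B.card)]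

/-- If instead every `S`-neighbour of `u` is adjacent to `a`, then the missing edges have small
degrees, and they all meet the neighbourhoods of the ends of one of them. -/
lemma IsStrongClique.card_edgesMissing_le_of_forall_adj (hS : G.IsStrongClique (S : Set (Sym2 V)))
    {u a : V} (hua : ∀ v, s(u, v) ∈ S → G.Adj v a)
    (ha : ∀ x, (edgeNbrs (G.edgesMissing S u) x).card ≤ (edgeNbrs (G.edgesMissing S u) a).card) :
    ((G.edgesMissing S u).card : ℤ) ≤ (G.maxDegree - (edgeNbrs S u).card) *
      (2 * G.maxDegree - (edgeNbrs S u).card) := by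
  set M := G.edgesMissing S u with hM
  have hsub : edgeNbrs S u ⊆ G.neighborFinset a := by
    intro v hv
    simpa using (hua v (mem_edgeNbrs.1 hv)).symm
  have h1 := Finset.card_sdiff_add_card_eq_card hsub
  have h2 : (G.neighborFinset a).card ≤ G.maxDegree := G.degree_le_maxDegree a
  have hd := hS.card_edgeNbrs_le u
  rcases (edgeNbrs M a).eq_empty_or_nonempty with he | ⟨b, hb⟩
  · have hM0 : M.card ≤ 0 := by
      refine (card_le_sum_card_edgeNbrs (N := Finset.univ) (by simp)).trans ?_
      refine (sum_card_edgeNbrs_le_mul (d := 0) fun x => ?_).trans (by simp)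
      simpa [he] using ha x
    zify at hM0 hd
    nlinarith
  have hbM := mem_edgeNbrs.1 hb
  have hMS : ∀ {x y}, s(x, y) ∈ M → s(x, y) ∈ S := fun h => (mem_edgesMissing.1 h).1
  have hea : (edgeNbrs M a).card ≤ (G.neighborFinset a \ edgeNbrs S u).card := by
    refine Finset.card_le_card fun c hc => ?_
    rw [mem_edgeNbrs, hM, mem_edgesMissing] at hc
    simp only [Finset.mem_sdiff, mem_neighborFinset, mem_edgeNbrs]
    exact ⟨hS.adj hc.1, fun h => hc.2.2 (hS.adj h)⟩
  have hcount := card_le_sum_card_edgeNbrs (S := M)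
    (N := (G.neighborFinset a \ edgeNbrs S u) ∪ G.neighborFinset b) (by
      intro x y hxy
      obtain ⟨hxyS, hx, hy⟩ := mem_edgesMissing.1 hxy
      have hx' : s(u, x) ∉ S := fun h => hx (hS.adj h)
      have hy' : s(u, y) ∉ S := fun h => hy (hS.adj h)
      simp only [Finset.mem_union, Finset.mem_sdiff, mem_neighborFinset, mem_edgeNbrs, hx', hy',
        not_false_eq_true, and_true]
      by_contra! h
      exact (hS.adj_or_adj (hMS hbM) hxyS h.1.1 h.2.1).elim h.1.2 h.2.2)
  have h3 : (G.neighborFinset b).card ≤ G.maxDegree := G.degree_le_maxDegree b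
  have h4 := (hcount.trans (sum_card_edgeNbrs_le_mul ha)).trans (Nat.mul_le_mul_right _
    (Finset.card_union_le _ _))
  have h5 : M.card ≤ ((G.maxDegree - (edgeNbrs S u).card) + G.maxDegree) *
      (G.maxDegree - (edgeNbrs S u).card) :=
    h4.trans (Nat.mul_le_mul (by omega) (by omega))
  zify [hd] at h5
  linarith

lemma IsStrongClique.four_mul_card_le_of_cliqueFree (hS : G.IsStrongClique (S : Set (Sym2 V)))
    (hG : G.CliqueFree 3) : 4 * S.card ≤ 5 * G.maxDegree ^ 2 := by
  rcases S.eq_empty_or_nonempty with rfl | ⟨e, he⟩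
  · simp
  have : Nonempty V := ⟨e.out.1⟩
  obtain ⟨u, hu⟩ := exists_card_edgeNbrs_max S
  obtain ⟨a, ha⟩ := exists_card_edgeNbrs_max (G.edgesMissing S u)
  have hd := hS.card_edgeNbrs_le u
  have hsum := card_le_mul_add_card_edgesMissing (G := G) (u := u) hu
  rcases le_or_gt (2 * (edgeNbrs S u).card) G.maxDegree with hsmall | hlarge
  · -- All edges of `S` meet the neighbourhoods of the two ends of one of them.
    have h : S.card ≤ 2 * (G.maxDegree * (edgeNbrs S u).card) := by
      induction e with
      | _ x y =>
        have h1 := hS.card_le_sum_add_sum_neighborFinset he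
        have h2 : ∀ z, ∑ w ∈ G.neighborFinset z, (edgeNbrs S w).card ≤
            G.maxDegree * (edgeNbrs S u).card := fun z =>
          (sum_card_edgeNbrs_le_mul hu).trans
            (Nat.mul_le_mul_right _ (G.degree_le_maxDegree z))
        have h3 := h2 x
        have h4 := h2 y
        omega
    nlinarith
  · zify at hsum hd hlarge ⊢
    by_cases h : ∀ v, s(u, v) ∈ S → G.Adj v a
    · have := hS.card_edgesMissing_le_of_forall_adj h ha
      nlinarith
    · push Not at h
      obtain ⟨v, huv, hva⟩ := h
      have := hS.card_edgesMissing_le_of_not_adj hG huv hva ha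
      nlinarith

end Bounds

end SimpleGraph

theorem mainTheorem1 {V : Type*} [Fintype V] (G : SimpleGraph V) [DecidableRel G.Adj]
    (Δ : ℕ) (hΔ : G.maxDegree = Δ) :
    (G.CliqueFree 3 → (G.strongCliqueNum : ℝ) ≤ 5 / 4 * (Δ : ℝ) ^ 2) ∧
    ((SimpleGraph.cycleGraph 5).Free G → G.strongCliqueNum ≤ Δ ^ 2) ∧
    (∀ k : ℕ, 3 ≤ k → (SimpleGraph.cycleGraph (2 * k + 1)).Free G →
      3 * k ^ 2 + 10 * k ≤ Δ → G.strongCliqueNum ≤ Δ ^ 2) := by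
  classical
  subst hΔ
  refine ⟨fun hG => ?_, fun hG => ?_, fun k hk hG hkΔ => ?_⟩
  · have h : G.strongCliqueNum ≤ 5 * G.maxDegree ^ 2 / 4 :=
      SimpleGraph.strongCliqueNum_le fun S hS => by
        have := hS.four_mul_card_le_of_cliqueFree hG
        omega
    have h' : 4 * G.strongCliqueNum ≤ 5 * G.maxDegree ^ 2 := by omega
    have h'' : (4 * G.strongCliqueNum : ℝ) ≤ 5 * (G.maxDegree : ℝ) ^ 2 := by exact_mod_cast h'
    linarith
  · exact SimpleGraph.strongCliqueNum_le fun S hS => hS.card_le_of_cycleGraph_five_free hG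
  · exact SimpleGraph.strongCliqueNum_le fun S hS =>
      hS.card_le_of_cycleGraph_free hk hG (by nlinarith)
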